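/- Let $(E,H,F)$ be a principal $\mathfrak{sl}_2$-triple in $\mathfrak{sl}_n(\mathbb{C})$: $[E,F]=H\neq 0$, $[H,E]=2E$, $[H,F]=-2F$, and every nonzero nilpotent element of the span of $E,H,F$ (a copy of $\mathfrak{sl}_2$) is a nilpotent matrix whose centralizer in $\mathfrak{sl}_n(\mathbb{C})$ has the minimal dimension $n-1$. For $1\le i\le n-1$ and $-i\le j\le i$ put $G_{i,j}=\mathrm{ad}_F^{\,i-j}(E^i)$, where $E^i$ is the matrix power. These elements form a basis of $\mathfrak{sl}_n(\mathbb{C})$. For $k,\ell\ge 1$ and $m$ odd with $1\le m<2\min(k,\ell)$, let the structure constant $\omega_{k,\ell}^{(m)}\in\mathbb{C}$ be defined by the requirement that the coefficient of $[E^k,F^\ell]$ in front of the basis element $G_{k+\ell-m,\,k-\ell}$ is $$\frac{(-1)^\ell}{(2\ell-m)!}\,\omega_{k,\ell}^{(m)},$$ with $\omega_{k,\ell}^{(m)}=0$ if $k+\ell-m\ge n$. Then for all integers $1\le k,\ell\le n-1$ and all odd $m$ with $1\le m<2\min(k,\ell)$, with $m'=k+\ell-m$, one has $$(-1)^{k+1}\,(2m')!\,\operatorname{tr}(E^{m'}F^{m'})\,\omega_{k,\ell}^{(m)}=\operatorname{tr}(E^\ell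 F^\ell)\,\frac{(2k-m)!\,(2\ell)!}{m!}\,\omega_{m',k}^{(2k-m)}.$$ -/

import Mathlib

open scoped Nat

noncomputable section

namespace PrincipalBasis

/-- The Lie algebra `sl_n(ℂ)` of traceless complex `n × n` matrices. -/
abbrev SL (n : ℕ) : Type := LieAlgebra.SpecialLinear.sl (Fin n) ℂ

/-- An element of `sl_n(ℂ)` is principal nilpotent if it is a nilpotent matrix whose centralizer
in `sl_n(ℂ)` has the minimal dimension `n - 1`, the rank of `sl_n`. -/
def IsPrincipalNilpotent {n : ℕ} (X : SL n) : Prop :=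
  IsNilpotent (X : Matrix (Fin n) (Fin n) ℂ) ∧
    Module.finrank ℂ (LinearMap.ker (LieAlgebra.ad ℂ (SL n) X)) = n - 1

/-- A principal `sl₂`-triple of `sl_n(ℂ)`: every nonzero nilpotent element of the copy of `sl₂`
is principal nilpotent. The nilpotent elements of `sl₂` are the matrices `!![b, a; c, -b]` of
determinant zero, that is, the `a • e + b • h + c • f` with `b ^ 2 + a * c = 0`. -/
structure IsPrincipalTriple {n : ℕ} (E H F : SL n) : Prop where
  triple : IsSl2Triple H E F
  principal : ∀ a b c : ℂ, ¬ (a = 0 ∧ b = 0 ∧ c = 0) → b ^ 2 + a * c = 0 →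
    IsPrincipalNilpotent (a • E + b • H + c • F)

variable {n : ℕ}

/-- `G_{i,j} = ad_F^{i-j}(E^i)`, for `-i ≤ j ≤ i`. -/
def G (E F : Matrix (Fin n) (Fin n) ℂ) (i : ℕ) (j : ℤ) : Matrix (Fin n) (Fin n) ℂ :=
  ((fun X => ⁅F, X⁆)^[((i : ℤ) - j).toNat]) (E ^ i)

/-- The index set of the `G_{i,j}`: `1 ≤ i ≤ n - 1` and `-i ≤ j ≤ i`. -/
def gIndex (n : ℕ) : Set (ℕ × ℤ) :=
  {p | 1 ≤ p.1 ∧ p.1 < n ∧ -(p.1 : ℤ) ≤ p.2 ∧ p.2 ≤ (p.1 : ℤ)}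

/-- `a` is a family of coefficients, zero outside the index set, with
`X = ∑ a_{i,j} G_{i,j}`. -/
def IsExpansion (E F X : Matrix (Fin n) (Fin n) ℂ) (a : ℕ × ℤ →₀ ℂ) : Prop :=
  (a.support : Set (ℕ × ℤ)) ⊆ gIndex n ∧ a.sum (fun p c => c • G E F p.1 p.2) = X

open Classical in
/-- The coefficient of `X` in front of `G_{i,j}`; it is zero if `(i, j)` is not an index. -/
def gCoeff (E F X : Matrix (Fin n) (Fin n) ℂ) (i : ℕ) (j : ℤ) : ℂ :=
  if h : ∃! a, IsExpansion E F X a then h.choose (i, j) else 0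

/-- The structure constant `ω_{k,ℓ}^{(m)}`, for `m` odd with `m < 2 min(k, ℓ)`, given by
`[E^k, F^ℓ] = ∑_m (-1)^ℓ ω_{k,ℓ}^{(m)} / (2ℓ - m)! • G_{k+ℓ-m, k-ℓ}`. -/
def structureConst (E F : Matrix (Fin n) (Fin n) ℂ) (k l m : ℕ) : ℂ :=
  (-1) ^ l * ((2 * l - m)! : ℂ) * gCoeff E F ⁅E ^ k, F ^ l⁆ (k + l - m) ((k : ℤ) - (l : ℤ))

end PrincipalBasis

end

/-! The form tr(XY) is invariant under all brackets. For it, G_{i,j} is orthogonal to every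
G_{i',j'} except G_{i,-j}, so each structure constant is read off from a trace (`gCoeff_mul_trace`).
Up to explicit factors, with P = E^{m'}, both constants are entries of one pairing T(a,b) =
tr(ad_F^a(E^k) [P, ad_F^b(E^ℓ)]): since ad_F^{2i}(E^i) = (-1)^i (2i)! F^i (`adPow_top`), they sit at
(2k-m, 2ℓ) and (2k, 2ℓ-m). As P commutes with E, invariance under ad_E gives a two-term recursion
linking these entries (`trace_pairing_recursion`), whence the factorials.

The basis claim needs F^i ≠ 0 for i < n. This follows from the centralizer dimension through the
bound dim C(f) ≥ dim V + d² - d for nilpotent f, with d = dim ker f. Independence and spanning then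
follow from distinct eigenvalues and a count. -/

/-! ### Commutants of nilpotent endomorphisms -/

/-- The endomorphisms commuting with `f`. -/
def commutant {K V : Type*} [Field K] [AddCommGroup V] [Module K V] (f : Module.End K V) :
    Submodule K (Module.End K V) :=
  LinearMap.ker (LinearMap.mulLeft K f - LinearMap.mulRight K f)

theorem mem_commutant {K V : Type*} [Field K] [AddCommGroup V] [Module K V]
    {f X : Module.End K V} : X ∈ commutant f ↔ ∀ v, f (X v) = X (f v) := by
  simp only [commutant, LinearMap.mem_ker, LinearMap.sub_apply, LinearMap.mulLeft_apply,
    LinearMap.mulRight_apply, sub_eq_zero, LinearMap.ext_iff, Module.End.mul_apply]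

/-- The restriction of an endomorphism to its range. -/
def restrictRange {K V : Type*} [Field K] [AddCommGroup V] [Module K V] (f : Module.End K V) :
    Module.End K (LinearMap.range f) :=
  f.restrict (p := LinearMap.range f) (q := LinearMap.range f) fun v _ => ⟨v, rfl⟩

/-- An endomorphism of the range of `f` commuting with `f` extends to one of the whole space. -/
theorem exists_extension_mem_commutant {K V : Type*} [Field K] [AddCommGroup V] [Module K V]
    (f : Module.End K V) (Y : Module.End K (LinearMap.range f))
    (hY : Y ∈ commutant (restrictRange f)) :
    ∃ X ∈ commutant f, ∀ w : LinearMap.range f, X w = Y w := by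
  obtain ⟨s, hs⟩ := f.rangeRestrict.exists_rightInverse_of_surjective
    (LinearMap.range_rangeRestrict f)
  have hs' : ∀ w : LinearMap.range f, f (s w) = w := fun w => by
    have := congrArg Subtype.val (LinearMap.congr_fun hs w)
    simpa using this
  -- Here f ∘ X₀ = Y ∘ f. On the range, X₀ - Y takes values in ker f; subtracting a ker f-valued
  -- extension of it leaves f ∘ X₀ unchanged.
  let X₀ : Module.End K V := s ∘ₗ Y ∘ₗ f.rangeRestrict
  have hX₀ : ∀ v, f (X₀ v) = Y (f.rangeRestrict v) := fun v => hs' _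
  rw [mem_commutant] at hY
  have hY' : ∀ w : LinearMap.range f, f (Y w) = Y (f.rangeRestrict w) := fun w => by
    have := congrArg Subtype.val (hY w)
    exact this
  let D : LinearMap.range f →ₗ[K] LinearMap.ker f :=
    LinearMap.codRestrict _ (X₀ ∘ₗ (LinearMap.range f).subtype - (LinearMap.range f).subtype ∘ₗ Y)
      fun w => by
        rw [LinearMap.mem_ker, LinearMap.sub_apply, map_sub, sub_eq_zero]
        exact (hX₀ w).trans (hY' w).symm
  obtain ⟨D', hD'⟩ := LinearMap.exists_extend D
  have hD : ∀ w : LinearMap.range f, (D' (w : V) : V) = X₀ w - Y w := fun w => by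
    have := congrArg Subtype.val (LinearMap.congr_fun hD' w)
    exact this
  have hX : ∀ w : LinearMap.range f, (X₀ - (LinearMap.ker f).subtype ∘ₗ D') w = Y w := fun w => by
    simp [hD]
  refine ⟨X₀ - (LinearMap.ker f).subtype ∘ₗ D', ?_, hX⟩
  rw [mem_commutant]
  intro v
  have h1 := hX (f.rangeRestrict v)
  change (X₀ - (LinearMap.ker f).subtype ∘ₗ D') (f v) = _ at h1
  rw [h1, ← hX₀]
  simp

/-- Rank-nullity for restriction to the range of f: the image contains the commutant of the
restricted map, and the kernel contains Hom(V / range f, ker f). -/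
theorem finrank_commutant_restrictRange_add_le {K V : Type*} [Field K] [AddCommGroup V]
    [Module K V] [FiniteDimensional K V] (f : Module.End K V) :
    Module.finrank K (commutant (restrictRange f)) + Module.finrank K (LinearMap.ker f) ^ 2 ≤
      Module.finrank K (commutant f) := by
  let ρ : commutant f →ₗ[K] (LinearMap.range f →ₗ[K] V) :=
    (LinearMap.lcomp K V (LinearMap.range f).subtype) ∘ₗ (commutant f).subtype
  have hρ : ∀ (X : commutant f) (w : LinearMap.range f), ρ X w = X.1 w := fun _ _ => rfl
  rw [← LinearMap.finrank_range_add_finrank_ker ρ]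
  refine add_le_add ?_ ?_
  · let ι : commutant (restrictRange f) →ₗ[K] (LinearMap.range f →ₗ[K] V) :=
      (LinearMap.compRight K (LinearMap.range f).subtype) ∘ₗ (commutant (restrictRange f)).subtype
    have hι : Function.Injective ι := by
      intro Y Z h
      ext w
      exact LinearMap.congr_fun h w
    rw [← LinearMap.finrank_range_of_inj hι]
    refine Submodule.finrank_mono ?_
    rintro _ ⟨Y, rfl⟩
    obtain ⟨X, hX, h⟩ := exists_extension_mem_commutant f Y.1 Y.2
    exact ⟨⟨X, hX⟩, LinearMap.ext h⟩
  · have hd : Module.finrank K (V ⧸ LinearMap.range f) = Module.finrank K (LinearMap.ker f) := by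
      have h1 := Submodule.finrank_quotient_add_finrank (LinearMap.range f)
      have h2 := LinearMap.finrank_range_add_finrank_ker f
      omega
    have h3 : Module.finrank K ((V ⧸ LinearMap.range f) →ₗ[K] LinearMap.ker f) =
        Module.finrank K (LinearMap.ker f) ^ 2 := by
      rw [Module.finrank_linearMap, hd, sq]
    rw [← h3]
    let Φ : ((V ⧸ LinearMap.range f) →ₗ[K] LinearMap.ker f) →ₗ[K] Module.End K V :=
      (LinearMap.compRight K (LinearMap.ker f).subtype) ∘ₗ
        (LinearMap.lcomp K (LinearMap.ker f) (LinearMap.range f).mkQ)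
    have hΦ : ∀ A v, Φ A v = A ((LinearMap.range f).mkQ v) := fun _ _ => rfl
    have hz : ∀ A v, Φ A (f v) = 0 := fun A v => by
      rw [hΦ, (LinearMap.mem_ker.1 (by simp) : (LinearMap.range f).mkQ (f v) = 0)]
      simp
    let Ψ : ((V ⧸ LinearMap.range f) →ₗ[K] LinearMap.ker f) →ₗ[K] LinearMap.ker ρ :=
      LinearMap.codRestrict _ (LinearMap.codRestrict _ Φ fun A => by
        rw [mem_commutant]
        intro v
        rw [hz, hΦ]
        exact (A _).2) fun A => by
        rw [LinearMap.mem_ker]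
        ext ⟨_, v, rfl⟩
        exact hz A v
    refine LinearMap.finrank_le_finrank_of_injective (f := Ψ) ?_
    intro A B h
    ext v
    have : Φ A = Φ B := congrArg (fun Z => Z.1.1) h
    exact LinearMap.congr_fun this v

theorem finrank_add_finrank_ker_sq_le {K : Type*} [Field K] (N : ℕ) :
    ∀ (V : Type*) [AddCommGroup V] [Module K V] [FiniteDimensional K V] (f : Module.End K V),
      IsNilpotent f → Module.finrank K V ≤ N →
      Module.finrank K V + Module.finrank K (LinearMap.ker f) ^ 2 ≤
        Module.finrank K (commutant f) + Module.finrank K (LinearMap.ker f) := by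
  induction N with
  | zero =>
    intro V _ _ _ f _ hN
    have := Submodule.finrank_le (LinearMap.ker f)
    have h0 : Module.finrank K (LinearMap.ker f) = 0 := by omega
    rw [h0]
    omega
  | succ N ih =>
    intro V _ _ _ f hf hN
    have hrk := LinearMap.finrank_range_add_finrank_ker f
    have hg : IsNilpotent (restrictRange f) := by
      obtain ⟨k, hk⟩ := hf
      refine ⟨k, LinearMap.ext fun w => Subtype.ext ?_⟩
      have h : ∀ j, ((restrictRange f ^ j) w : V) = (f ^ j) w := by
        intro j
        induction j with
        | zero => simp
        | succ j ihj =>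
          rw [pow_succ', pow_succ', Module.End.mul_apply, Module.End.mul_apply, ← ihj]
          rfl
      rw [h, hk]
      simp
    rcases Nat.eq_zero_or_pos (Module.finrank K (LinearMap.ker f)) with h0 | hpos
    · have hinj : Function.Injective f := by
        rw [← LinearMap.ker_eq_bot]
        exact Submodule.finrank_eq_zero.1 h0
      obtain ⟨k, hk⟩ := hf
      have hinj' : Function.Injective (f ^ k) := by
        rw [Module.End.coe_pow]
        exact hinj.iterate k
      have : Subsingleton V := ⟨fun a b => hinj' (by rw [hk]; simp)⟩
      rw [h0, Module.finrank_zero_of_subsingleton]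
      simp
    -- The kernel is nonzero, so the range has smaller dimension.
    · have h1 := ih (LinearMap.range f) (restrictRange f) hg (by omega)
      have h2 := finrank_commutant_restrictRange_add_le f
      have h3 : Module.finrank K (LinearMap.ker (restrictRange f)) ≤
          Module.finrank K (LinearMap.ker (restrictRange f)) ^ 2 := Nat.le_self_pow two_ne_zero _
      omega

/-- Each further application of f lowers the rank by at most dim ker f. -/
theorem finrank_le_finrank_range_pow_add {K V : Type*} [Field K] [AddCommGroup V] [Module K V]
    [FiniteDimensional K V] (f : Module.End K V) (k : ℕ) :
    Module.finrank K V ≤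
      Module.finrank K (LinearMap.range (f ^ k)) + k * Module.finrank K (LinearMap.ker f) := by
  induction k with
  | zero =>
    rw [pow_zero, Module.End.one_eq_id, LinearMap.range_id, finrank_top]
    omega
  | succ k ih =>
    have h1 := LinearMap.finrank_range_add_finrank_ker (f.domRestrict (LinearMap.range (f ^ k)))
    have h2 : LinearMap.range (f.domRestrict (LinearMap.range (f ^ k))) =
        LinearMap.range (f ^ (k + 1)) := by
      rw [pow_succ', Module.End.mul_eq_comp, LinearMap.range_comp, LinearMap.range_domRestrict]
    have h3 : Module.finrank K (LinearMap.ker (f.domRestrict (LinearMap.range (f ^ k)))) ≤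
        Module.finrank K (LinearMap.ker f) := by
      rw [LinearMap.ker_domRestrict]
      refine LinearMap.finrank_le_finrank_of_injective
        (f := LinearMap.codRestrict (LinearMap.ker f)
          ((LinearMap.range (f ^ k)).subtype ∘ₗ
            (Submodule.comap (LinearMap.range (f ^ k)).subtype (LinearMap.ker f)).subtype)
          fun x => x.2) ?_
      intro x y h
      exact Subtype.ext (Subtype.ext (congrArg (fun z : LinearMap.ker f => (z : V)) h))
    rw [h2] at h1
    rw [add_mul]
    omega

/-- A nilpotent endomorphism with small commutant has maximal nilpotency order. -/
theorem pow_ne_zero_of_finrank_commutant_le {K V : Type*} [Field K] [AddCommGroup V] [Module K V]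
    [FiniteDimensional K V] (f : Module.End K V) (hf : IsNilpotent f)
    (hc : Module.finrank K (commutant f) ≤ Module.finrank K V) {i : ℕ}
    (hi : i < Module.finrank K V) : f ^ i ≠ 0 := by
  intro h0
  have h1 := finrank_add_finrank_ker_sq_le _ V f hf le_rfl
  have h2 : Module.finrank K (LinearMap.ker f) ≤ 1 := by nlinarith
  have h3 := finrank_le_finrank_range_pow_add f i
  rw [h0, LinearMap.range_zero, finrank_bot] at h3
  nlinarith

namespace PrincipalBasis

section

attribute [local instance] LieRing.ofAssociativeRing

/-! ### Powers of principal nilpotent matrices -/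

theorem IsPrincipalNilpotent.pow_ne_zero {n : ℕ} {X : SL n} (hX : IsPrincipalNilpotent X)
    {i : ℕ} (hi : i < n) : X.1 ^ i ≠ 0 := by
  obtain ⟨hnil, hdim⟩ := hX
  set M : Matrix (Fin n) (Fin n) ℂ := X.1
  let e := Matrix.toLinAlgEquiv' (R := ℂ) (n := Fin n)
  have hc : Module.finrank ℂ (commutant (e M)) ≤ n := by
    -- The trace-zero part of the commutant has codimension at most one and embeds in the
    -- centralizer in sl_n.
    let τ : commutant (e M) →ₗ[ℂ] ℂ :=
      Matrix.traceLinearMap (Fin n) ℂ ℂ ∘ₗ e.symm.toLinearMap ∘ₗ (commutant (e M)).subtype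
    have h1 := LinearMap.finrank_range_add_finrank_ker (K := ℂ) (V := commutant (e M)) (V₂ := ℂ) τ
    have h2 : Module.finrank ℂ (LinearMap.range τ) ≤ 1 := by
      simpa using Submodule.finrank_le (LinearMap.range τ)
    have hcomm : ∀ Y : commutant (e M), M * e.symm Y.1 = e.symm Y.1 * M := by
      intro Y
      apply e.injective
      rw [map_mul, map_mul, AlgEquiv.apply_symm_apply]
      exact LinearMap.ext (mem_commutant.1 Y.2)
    let Φ : LinearMap.ker τ →ₗ[ℂ] LinearMap.ker (LieAlgebra.ad ℂ (SL n) X) :=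
      LinearMap.codRestrict _ (LinearMap.codRestrict
        (LieAlgebra.SpecialLinear.sl (Fin n) ℂ).toSubmodule
        (e.symm.toLinearMap ∘ₗ (commutant (e M)).subtype ∘ₗ (LinearMap.ker τ).subtype)
        (fun Y => Y.2)) fun Y => by
          rw [LinearMap.mem_ker, LieAlgebra.ad_apply]
          apply Subtype.ext
          change M * e.symm Y.1.1 - e.symm Y.1.1 * M = 0
          rw [hcomm, sub_self]
    have h3 := LinearMap.finrank_le_finrank_of_injective (f := Φ) (by
      intro Y Z h
      have h' : (Φ Y).1.1 = (Φ Z).1.1 := by rw [h]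
      have : e.symm Y.1.1 = e.symm Z.1.1 := h'
      exact Subtype.ext (Subtype.ext (e.symm.injective this)))
    omega
  have h := pow_ne_zero_of_finrank_commutant_le (e M) (hnil.map e) (by simpa using hc) (i := i)
    (by simpa using hi)
  rw [← map_pow] at h
  exact fun h0 => h (by rw [h0, map_zero])

/-! ### The `ad_F`-strings through the powers of E -/

/-- `ad_F^a (E^i)`. -/
def adPow {n : ℕ} (E F : Matrix (Fin n) (Fin n) ℂ) (i a : ℕ) : Matrix (Fin n) (Fin n) ℂ :=
  (LieModule.toEnd ℂ (Matrix (Fin n) (Fin n) ℂ) (Matrix (Fin n) (Fin n) ℂ) F ^ a) (E ^ i)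

variable {n : ℕ} {E H F : Matrix (Fin n) (Fin n) ℂ}

theorem adPow_zero (i : ℕ) : adPow E F i 0 = E ^ i := by simp [adPow]

theorem adPow_succ (i a : ℕ) : adPow E F i (a + 1) = ⁅F, adPow E F i a⁆ := by
  simp [adPow, pow_succ']

theorem G_eq_adPow {i a : ℕ} {j : ℤ} (h : (a : ℤ) = i - j) : G E F i j = adPow E F i a := by
  unfold G adPow
  rw [Module.End.pow_apply, ← h, Int.toNat_natCast]
  rfl

theorem lie_mul_eq (X Y Z : Matrix (Fin n) (Fin n) ℂ) : ⁅X, Y * Z⁆ = ⁅X, Y⁆ * Z + Y * ⁅X, Z⁆ := by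
  simp only [Ring.lie_def]
  noncomm_ring

theorem lie_E_pow (i : ℕ) : ⁅E, E ^ i⁆ = 0 := by
  rw [Ring.lie_def, ← pow_succ, ← pow_succ', sub_self]

theorem lie_H_pow (t : IsSl2Triple H E F) (i : ℕ) : ⁅H, E ^ i⁆ = (2 * i : ℂ) • E ^ i := by
  induction i with
  | zero => simp [Ring.lie_def]
  | succ i ih =>
    rw [pow_succ, lie_mul_eq, ih, t.lie_h_e_smul ℂ, smul_mul_assoc, mul_smul_comm, ← add_smul]
    push_cast
    congr 1
    ring

theorem hasPrimitiveVectorWith_pow (t : IsSl2Triple H E F) {i : ℕ} (h : E ^ i ≠ 0) :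
    t.HasPrimitiveVectorWith (E ^ i) (2 * i : ℂ) :=
  ⟨h, lie_H_pow t i, lie_E_pow i⟩

theorem lie_H_adPow (t : IsSl2Triple H E F) (i a : ℕ) :
    ⁅H, adPow E F i a⁆ = (2 * i - 2 * a : ℂ) • adPow E F i a := by
  by_cases h : E ^ i = 0
  · simp [adPow, h]
  · exact (hasPrimitiveVectorWith_pow t h).lie_h_pow_toEnd_f a

theorem lie_E_adPow_succ (t : IsSl2Triple H E F) (i a : ℕ) :
    ⁅E, adPow E F i (a + 1)⁆ = ((a + 1) * (2 * i - a) : ℂ) • adPow E F i a := by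
  by_cases h : E ^ i = 0
  · simp [adPow, h]
  · exact (hasPrimitiveVectorWith_pow t h).lie_e_pow_succ_toEnd_f a

/-- Leibniz rule for E^i · E: the string of E is E, -H, -2F, 0, so only three terms survive. -/
theorem adPow_mul (t : IsSl2Triple H E F) (i a : ℕ) :
    adPow E F (i + 1) (a + 2) = adPow E F i (a + 2) * E - (a + 2 : ℂ) • (adPow E F i (a + 1) * H) -
      ((a + 2) * (a + 1) : ℂ) • (adPow E F i a * F) := by
  have hFE : ⁅F, E⁆ = -H := by rw [← lie_skew, t.lie_e_f]
  have hFH : ⁅F, H⁆ = (2 : ℂ) • F := by rw [← lie_skew, t.lie_lie_smul_f ℂ, neg_neg]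
  have hFF : ⁅F, F⁆ = 0 := lie_self F
  induction a with
  | zero =>
    simp only [zero_add, adPow_succ, adPow_zero, pow_succ E i, lie_mul_eq, hFE, hFH, lie_add,
      mul_neg, lie_neg, mul_smul_comm, CharP.cast_eq_zero, mul_one]
    module
  | succ a ih =>
    rw [adPow_succ, ih, lie_sub, lie_sub, lie_smul, lie_smul, lie_mul_eq, lie_mul_eq, lie_mul_eq,
      hFE, hFH, hFF, ← adPow_succ, ← adPow_succ, ← adPow_succ, mul_smul_comm, mul_neg, mul_zero]
    push_cast
    module

/-- The vanishing beyond 2i is carried through the induction: it leaves only the F-term of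
`adPow_mul`. -/
theorem adPow_top (t : IsSl2Triple H E F) (i : ℕ) :
    adPow E F i (2 * i) = ((-1) ^ i * ((2 * i)! : ℂ)) • F ^ i ∧ adPow E F i (2 * i + 1) = 0 := by
  induction i with
  | zero => simp [adPow_succ, adPow_zero, Ring.lie_def]
  | succ i ih =>
    have h2 : adPow E F i (2 * i + 2) = 0 := by rw [adPow_succ, ih.2, lie_zero]
    have h3 : adPow E F i (2 * i + 1 + 2) = 0 := by rw [adPow_succ, h2, lie_zero]
    have e1 : 2 * (i + 1) = 2 * i + 2 := by ring
    have e2 : 2 * (i + 1) + 1 = 2 * i + 1 + 2 := by ring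
    constructor
    · rw [e1, adPow_mul t, ih.1, ih.2, h2, zero_mul, zero_mul, smul_zero, sub_zero, zero_sub,
        smul_mul_assoc, smul_smul, ← pow_succ, ← neg_smul, Nat.factorial_succ (2 * i + 1),
        Nat.factorial_succ (2 * i)]
      congr 1
      push_cast
      ring
    · rw [e2, adPow_mul t, ih.2, h2, h3]
      simp

theorem adPow_eq_zero (t : IsSl2Triple H E F) {i a : ℕ} (h : 2 * i < a) : adPow E F i a = 0 := by
  obtain ⟨b, rfl⟩ := Nat.exists_eq_add_of_lt h
  induction b with
  | zero => exact (adPow_top t i).2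
  | succ b ih =>
    rw [show 2 * i + (b + 1) + 1 = 2 * i + b + 1 + 1 by ring, adPow_succ, ih (by omega), lie_zero]

theorem adPow_ne_zero (t : IsSl2Triple H E F) {i a : ℕ} (hF : F ^ i ≠ 0) (h : a ≤ 2 * i) :
    adPow E F i a ≠ 0 := by
  intro h0
  have h1 : ∀ b, adPow E F i (a + b) = 0 := fun b => by
    induction b with
    | zero => exact h0
    | succ b ih => rw [← add_assoc, adPow_succ, ih, lie_zero]
  have h2 := h1 (2 * i - a)
  rw [Nat.add_sub_cancel' h, (adPow_top t i).1, smul_eq_zero] at h2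
  refine h2.elim (fun h => ?_) hF
  have := Nat.factorial_ne_zero (2 * i)
  simp_all

/-! ### The invariant trace form -/

theorem trace_lie (X Y : Matrix (Fin n) (Fin n) ℂ) : ⁅X, Y⁆.trace = 0 := by
  rw [Ring.lie_def, Matrix.trace_sub, Matrix.trace_mul_comm, sub_self]

theorem trace_lie_mul (X Y Z : Matrix (Fin n) (Fin n) ℂ) :
    (⁅X, Y⁆ * Z).trace = -(Y * ⁅X, Z⁆).trace := by
  simp only [Ring.lie_def, sub_mul, mul_sub, Matrix.trace_sub]
  rw [mul_assoc X Y Z, Matrix.trace_mul_comm X (Y * Z), mul_assoc, mul_assoc]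
  ring

theorem trace_toEnd_pow_mul (a : ℕ) (X Y : Matrix (Fin n) (Fin n) ℂ) :
    ((LieModule.toEnd ℂ (Matrix (Fin n) (Fin n) ℂ) (Matrix (Fin n) (Fin n) ℂ) F ^ a) X * Y).trace =
      (-1) ^ a * (X * (LieModule.toEnd ℂ (Matrix (Fin n) (Fin n) ℂ)
        (Matrix (Fin n) (Fin n) ℂ) F ^ a) Y).trace := by
  induction a generalizing Y with
  | zero => simp
  | succ a ih =>
    rw [pow_succ', Module.End.mul_apply, LieModule.toEnd_apply_apply, trace_lie_mul, ih,
      ← LieModule.toEnd_apply_apply ℂ, ← Module.End.mul_apply, ← pow_succ, ← pow_succ']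
    ring

theorem trace_adPow_mul_adPow (i a i' b : ℕ) :
    (adPow E F i a * adPow E F i' b).trace = (-1) ^ a * (E ^ i * adPow E F i' (a + b)).trace := by
  rw [adPow, trace_toEnd_pow_mul, adPow, ← Module.End.mul_apply, ← pow_add, adPow]

theorem trace_adPow_mul_adPow_dual (t : IsSl2Triple H E F) {i a b : ℕ} (h : a + b = 2 * i) :
    (adPow E F i a * adPow E F i b).trace =
      (-1) ^ a * ((-1) ^ i * ((2 * i)! : ℂ) * (E ^ i * F ^ i).trace) := by
  rw [trace_adPow_mul_adPow, h, (adPow_top t i).1, mul_smul_comm, Matrix.trace_smul, smul_eq_mul]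

theorem trace_adPow_mul_adPow_eq_zero_of_weight (t : IsSl2Triple H E F) {i a i' b : ℕ}
    (h : a + b ≠ i + i') : (adPow E F i a * adPow E F i' b).trace = 0 := by
  have h1 := trace_lie_mul H (adPow E F i a) (adPow E F i' b)
  rw [lie_H_adPow t, lie_H_adPow t, smul_mul_assoc, mul_smul_comm, Matrix.trace_smul,
    Matrix.trace_smul, smul_eq_mul, smul_eq_mul] at h1
  have h2 : (((i + i' : ℕ) : ℂ) - ((a + b : ℕ) : ℂ)) *
      (adPow E F i a * adPow E F i' b).trace = 0 := by
    push_cast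
    linear_combination h1 / 2
  refine (mul_eq_zero.1 h2).resolve_left fun h3 => h ?_
  exact_mod_cast (sub_eq_zero.1 h3).symm

/-- Weights force a + b = i + i'. If i ≠ i', this exceeds 2 min(i, i'), so moving every ad_F onto
the shorter string kills it. -/
theorem trace_adPow_mul_adPow_eq_zero (t : IsSl2Triple H E F) {i a i' b : ℕ}
    (h : i ≠ i' ∨ a + b ≠ i + i') : (adPow E F i a * adPow E F i' b).trace = 0 := by
  by_cases hw : a + b = i + i'
  · rcases lt_or_gt_of_ne (h.resolve_right (not_not.2 hw)) with h | h
    · rw [Matrix.trace_mul_comm, trace_adPow_mul_adPow, adPow_eq_zero t (by omega)]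
      simp
    · rw [trace_adPow_mul_adPow, adPow_eq_zero t (by omega)]
      simp
  · exact trace_adPow_mul_adPow_eq_zero_of_weight t hw

theorem trace_G_mul_G_eq_zero (t : IsSl2Triple H E F) {i i' : ℕ} {j j' : ℤ} (hj : j ≤ i)
    (hj' : j' ≤ i') (h : i ≠ i' ∨ j + j' ≠ 0) : (G E F i j * G E F i' j').trace = 0 := by
  rw [G_eq_adPow (a := (i - j).toNat) (by omega), G_eq_adPow (a := (i' - j').toNat) (by omega)]
  exact trace_adPow_mul_adPow_eq_zero t (by omega)

/-! ### Linear independence -/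

/-- The operator `ad_F ad_E + ad_H² / 4 + ad_H` whose eigenvectors are the `G_{i,j}`. -/
noncomputable def casimirWeight (E H F : Matrix (Fin n) (Fin n) ℂ) :
    Module.End ℂ (Matrix (Fin n) (Fin n) ℂ) :=
  LieAlgebra.ad ℂ _ F * LieAlgebra.ad ℂ _ E +
    (4⁻¹ : ℂ) • (LieAlgebra.ad ℂ _ H * LieAlgebra.ad ℂ _ H) + LieAlgebra.ad ℂ _ H

theorem casimirWeight_apply (X : Matrix (Fin n) (Fin n) ℂ) :
    casimirWeight E H F X = ⁅F, ⁅E, X⁆⁆ + (4⁻¹ : ℂ) • ⁅H, ⁅H, X⁆⁆ + ⁅H, X⁆ := rfl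

theorem trace_casimirWeight (X : Matrix (Fin n) (Fin n) ℂ) :
    (casimirWeight E H F X).trace = 0 := by
  simp [casimirWeight_apply]

/-- The operator is the Casimir, with value i(i+1) on the i-th string, plus ad_H / 2, with value j =
i - a. -/
theorem casimirWeight_adPow (t : IsSl2Triple H E F) (i a : ℕ) :
    casimirWeight E H F (adPow E F i a) = (i ^ 2 + 2 * i - a : ℂ) • adPow E F i a := by
  have h : ⁅F, ⁅E, adPow E F i a⁆⁆ = (a * (2 * i - a + 1) : ℂ) • adPow E F i a := by
    cases a with
    | zero => simp [adPow_zero, lie_E_pow]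
    | succ a =>
      rw [lie_E_adPow_succ t, lie_smul, ← adPow_succ]
      push_cast
      congr 1
      ring
  rw [casimirWeight_apply, h, lie_H_adPow t, lie_smul, lie_H_adPow t, smul_smul, smul_smul,
    ← add_smul, ← add_smul]
  congr 1
  ring

theorem casimirWeight_G (t : IsSl2Triple H E F) {i : ℕ} {j : ℤ} (hj : j ≤ i) :
    casimirWeight E H F (G E F i j) = (((i : ℤ) ^ 2 + i + j : ℤ) : ℂ) • G E F i j := by
  obtain ⟨a, ha⟩ := Int.eq_ofNat_of_zero_le (sub_nonneg.2 hj)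
  rw [G_eq_adPow ha.symm, casimirWeight_adPow t]
  congr 1
  have : (j : ℤ) = i - a := by omega
  rw [this]
  push_cast
  ring

/-- The map `(i, j) ↦ i ^ 2 + i + j` from the indices to the eigenvalues. -/
def gValue (p : ℕ × ℤ) : ℤ := (p.1 : ℤ) ^ 2 + p.1 + p.2

/-- For fixed i the values fill the interval from i² to (i+1)² - 1, and these intervals tile. -/
theorem bijOn_gValue : Set.BijOn gValue (gIndex n) (Set.Ico 1 ((n : ℤ) ^ 2)) := by
  refine ⟨?_, ?_, ?_⟩
  · rintro ⟨i, j⟩ ⟨h1, h2, h3, h4⟩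
    dsimp only [gValue, Set.mem_Ico] at *
    zify at h1 h2
    constructor <;> nlinarith
  · rintro ⟨i, j⟩ ⟨h1, h2, h3, h4⟩ ⟨i', j'⟩ ⟨h1', h2', h3', h4'⟩ h
    dsimp only [gValue] at *
    have hi : i = i' := by
      zify at *
      rcases lt_trichotomy (i : ℤ) i' with hlt | heq | hlt
      · nlinarith
      · exact heq
      · nlinarith
    subst hi
    simpa using h
  · rintro v ⟨h1, h2⟩
    obtain ⟨w, rfl⟩ := Int.eq_ofNat_of_zero_le (by omega : 0 ≤ v)
    have a1 := Nat.sqrt_le' w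
    have a2 := Nat.lt_succ_sqrt' w
    have a3 : w < n ^ 2 := by exact_mod_cast h2
    have a4 : 1 ≤ w := by exact_mod_cast h1
    have a5 : Nat.sqrt w < n := lt_of_pow_lt_pow_left₀ 2 (Nat.zero_le _) (a1.trans_lt a3)
    have a6 : 1 ≤ Nat.sqrt w := Nat.sqrt_pos.2 a4
    refine ⟨(Nat.sqrt w, (w : ℤ) - (Nat.sqrt w) ^ 2 - Nat.sqrt w), ⟨a6, a5, ?_, ?_⟩, ?_⟩
    · zify at a1
      linarith
    · zify at a2
      nlinarith
    · simp only [gValue]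
      ring

theorem G_ne_zero (t : IsSl2Triple H E F) (hF : ∀ i < n, F ^ i ≠ 0) {p : ℕ × ℤ}
    (hp : p ∈ gIndex n) : G E F p.1 p.2 ≠ 0 := by
  obtain ⟨-, h2, h3, h4⟩ := hp
  rw [G_eq_adPow (a := (p.1 - p.2).toNat) (by omega)]
  exact adPow_ne_zero t (hF _ h2) (by omega)

theorem linearIndependent_G (t : IsSl2Triple H E F) (hF : ∀ i < n, F ^ i ≠ 0) :
    LinearIndependent ℂ (fun p : gIndex n => G E F p.1.1 p.1.2) := by
  refine Module.End.eigenvectors_linearIndependent' (casimirWeight E H F)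
    (fun p : gIndex n => ((gValue p.1 : ℤ) : ℂ)) ?_ _ fun p => ?_
  · intro p q h
    exact Subtype.ext (bijOn_gValue.injOn p.2 q.2 (Int.cast_injective (α := ℂ) h))
  · rw [Module.End.hasEigenvector_iff, Module.End.mem_eigenspace_iff]
    exact ⟨casimirWeight_G t p.2.2.2.2, G_ne_zero t hF p.2⟩

/-- An eigenvector with nonzero eigenvalue of an operator whose values are sums of commutators. -/
theorem trace_G (t : IsSl2Triple H E F) {p : ℕ × ℤ} (hp : p ∈ gIndex n) :
    (G E F p.1 p.2).trace = 0 := by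
  have h := trace_casimirWeight (E := E) (H := H) (F := F) (G E F p.1 p.2)
  rw [casimirWeight_G t hp.2.2.2, Matrix.trace_smul, smul_eq_mul] at h
  refine (mul_eq_zero.1 h).resolve_left fun h0 => ?_
  have h1 : gValue p = 0 := by exact_mod_cast h0
  have h2 := (bijOn_gValue.mapsTo hp).1
  omega

theorem span_G (t : IsSl2Triple H E F) (hF : ∀ i < n, F ^ i ≠ 0) :
    Submodule.span ℂ (Set.range fun p : gIndex n => G E F p.1.1 p.1.2) =
      LinearMap.ker (Matrix.traceLinearMap (Fin n) ℂ ℂ) := by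
  have hli := linearIndependent_G t hF
  refine Submodule.eq_of_le_of_finrank_le ?_ ?_
  · rw [Submodule.span_le]
    rintro _ ⟨p, rfl⟩
    exact trace_G t p.2
  · have := hli.finite
    have := Fintype.ofFinite (gIndex n)
    have hcard : Fintype.card (gIndex n) = n ^ 2 - 1 := by
      rw [← Nat.card_eq_fintype_card, Nat.card_congr (bijOn_gValue (n := n)).equiv,
        Nat.card_eq_fintype_card, Fintype.card_ofFinset, Int.card_Ico]
      have : ((n ^ 2 : ℕ) : ℤ) = (n : ℤ) ^ 2 := by push_cast; rfl
      omega
    rw [finrank_span_eq_card hli, hcard]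
    have hn : Nonempty (Fin n) := by
      by_contra h
      rw [not_nonempty_iff] at h
      exact t.h_ne_zero (Subsingleton.elim _ _)
    have h1 := LinearMap.finrank_range_add_finrank_ker (K := ℂ) (V := Matrix (Fin n) (Fin n) ℂ) (V₂ := ℂ)
      (Matrix.traceLinearMap (Fin n) ℂ ℂ)
    have hsurj : Function.Surjective (Matrix.traceLinearMap (Fin n) ℂ ℂ) := fun c =>
      ⟨Matrix.single hn.some hn.some c, by simp⟩
    rw [LinearMap.range_eq_top.2 hsurj, finrank_top, Module.finrank_self, Module.finrank_matrix,
      Module.finrank_self] at h1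
    simp only [Fintype.card_fin, mul_one, ← sq] at h1
    omega

/-! ### Coefficients -/

theorem existsUnique_isExpansion (t : IsSl2Triple H E F) (hF : ∀ i < n, F ^ i ≠ 0)
    {X : Matrix (Fin n) (Fin n) ℂ} (hX : X.trace = 0) : ∃! a, IsExpansion E F X a := by
  have hli : LinearIndepOn ℂ (fun p : ℕ × ℤ => G E F p.1 p.2) (gIndex n) :=
    linearIndependent_G t hF
  have hX' : X ∈ Submodule.span ℂ ((fun p : ℕ × ℤ => G E F p.1 p.2) '' gIndex n) := by
    rw [Set.image_eq_range, span_G t hF]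
    exact hX
  rw [Finsupp.mem_span_image_iff_linearCombination] at hX'
  obtain ⟨a, ha, hs⟩ := hX'
  refine ⟨a, ⟨ha, hs⟩, ?_⟩
  rintro b ⟨hb, hbs⟩
  rw [← sub_eq_zero]
  refine linearIndepOn_iff.1 hli (b - a) (Submodule.sub_mem _ hb ha) ?_
  rw [map_sub, hs, sub_eq_zero]
  exact hbs

theorem gCoeff_mul_trace (t : IsSl2Triple H E F) (hF : ∀ i < n, F ^ i ≠ 0)
    {X : Matrix (Fin n) (Fin n) ℂ} (hX : X.trace = 0) {i a b : ℕ} {j : ℤ}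
    (ha : (a : ℤ) = i - j) (hb : (b : ℤ) = i + j) :
    gCoeff E F X i j * (adPow E F i a * adPow E F i b).trace = (X * adPow E F i b).trace := by
  have hex := existsUnique_isExpansion t hF hX
  rw [gCoeff, dif_pos hex]
  obtain ⟨hs, hsum⟩ : IsExpansion E F X hex.choose := hex.choose_spec.1
  generalize hex.choose = c at *
  rw [← hsum, ← G_eq_adPow ha, ← G_eq_adPow (j := -j) (by omega), Finsupp.sum, Finset.sum_mul,
    Matrix.trace_sum, Finset.sum_eq_single (i, j)]
  · rw [smul_mul_assoc, Matrix.trace_smul, smul_eq_mul]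
  · intro p hp hne
    rw [smul_mul_assoc, Matrix.trace_smul,
      trace_G_mul_G_eq_zero t (hs hp).2.2.2 (by omega) ?_, smul_zero]
    by_contra! h
    exact hne (Prod.ext h.1 (by omega))
  -- This also covers (i, j) outside the index set, such as i ≥ n, where the coefficient is zero.
  · intro h
    rw [Finsupp.notMem_support_iff.1 h]
    simp

/-! ### The symmetry of the structure constants -/

theorem lie_mul_lie_trace {P : Matrix (Fin n) (Fin n) ℂ} (hP : ⁅E, P⁆ = 0)
    (X Y : Matrix (Fin n) (Fin n) ℂ) :
    (⁅E, X⁆ * ⁅P, Y⁆).trace + (X * ⁅P, ⁅E, Y⁆⁆).trace = 0 := by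
  rw [trace_lie_mul, leibniz_lie E P Y, hP, zero_lie, zero_add, neg_add_cancel]

theorem trace_pairing_recursion (t : IsSl2Triple H E F) {P : Matrix (Fin n) (Fin n) ℂ}
    (hP : ⁅E, P⁆ = 0) {k l A B m : ℕ} (hA : A + m = 2 * k) (hB : B + m = 2 * l) (i j : ℕ)
    (hij : i + j = m) :
    ((2 * l)! : ℂ) * i ! * A ! * j ! *
        (adPow E F k (A + i) * ⁅P, adPow E F l (B + j)⁆).trace =
      (-1) ^ i * (A + i)! * m ! * (B + j)! *
        (adPow E F k A * ⁅P, adPow E F l (2 * l)⁆).trace := by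
  induction i generalizing j with
  | zero =>
    obtain rfl : j = m := by omega
    rw [hB]
    simp only [add_zero, Nat.factorial_zero, pow_zero, Nat.cast_one]
    ring
  | succ i ih =>
    have h1 := ih (j + 1) (by omega)
    have h2 := lie_mul_lie_trace hP (adPow E F k (A + i + 1)) (adPow E F l (B + j + 1))
    rw [lie_E_adPow_succ t, lie_E_adPow_succ t, lie_smul, smul_mul_assoc, mul_smul_comm,
      Matrix.trace_smul, Matrix.trace_smul, smul_eq_mul, smul_eq_mul] at h2
    -- This turns the ad_E factors 2k - (A+i) and 2l - (B+j) into j+1 and i+1.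
    have hk : (2 * k : ℂ) = A + i + j + 1 := by
      exact_mod_cast (show 2 * k = A + i + j + 1 by omega)
    have hl : (2 * l : ℂ) = B + i + j + 1 := by
      exact_mod_cast (show 2 * l = B + i + j + 1 by omega)
    rw [hk, hl] at h2
    push_cast at h2
    have hB0 : (B + j + 1 : ℂ) ≠ 0 := by exact_mod_cast Nat.succ_ne_zero (B + j)
    rw [← add_assoc, Nat.factorial_succ j, Nat.factorial_succ (B + j)] at h1
    rw [← add_assoc, Nat.factorial_succ i, Nat.factorial_succ (A + i)]
    push_cast at h1 ⊢
    refine mul_left_cancel₀ hB0 ?_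
    linear_combination ((2 * l)! : ℂ) * i ! * A ! * j ! * h2 - (A + i + 1 : ℂ) * h1

theorem trace_pairing_symm (t : IsSl2Triple H E F) {P : Matrix (Fin n) (Fin n) ℂ}
    (hP : ⁅E, P⁆ = 0) {k l A B m : ℕ} (hA : A + m = 2 * k) (hB : B + m = 2 * l) :
    ((2 * l)! : ℂ) * A ! * (adPow E F k (2 * k) * ⁅P, adPow E F l B⁆).trace =
      (-1) ^ m * (2 * k)! * B ! * (adPow E F k A * ⁅P, adPow E F l (2 * l)⁆).trace := by
  have h := trace_pairing_recursion t hP hA hB m 0 (add_zero m)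
  have hm : (m ! : ℂ) ≠ 0 := by exact_mod_cast Nat.factorial_ne_zero m
  rw [hA, add_zero, Nat.factorial_zero, Nat.cast_one] at h
  refine mul_left_cancel₀ hm ?_
  linear_combination h

theorem trace_mul_lie_comm (X Y Z : Matrix (Fin n) (Fin n) ℂ) :
    (⁅X, Y⁆ * Z).trace = (X * ⁅Y, Z⁆).trace := by
  rw [← lie_skew, neg_mul, Matrix.trace_neg, trace_lie_mul, neg_neg]

theorem lie_F_pow_iterate (X : Matrix (Fin n) (Fin n) ℂ) (l a : ℕ) :
    (LieModule.toEnd ℂ (Matrix (Fin n) (Fin n) ℂ) (Matrix (Fin n) (Fin n) ℂ) F ^ a) ⁅X, F ^ l⁆ =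
      ⁅(LieModule.toEnd ℂ (Matrix (Fin n) (Fin n) ℂ) (Matrix (Fin n) (Fin n) ℂ) F ^ a) X,
        F ^ l⁆ := by
  induction a with
  | zero => simp
  | succ a ih =>
    rw [pow_succ', Module.End.mul_apply, Module.End.mul_apply, ih, LieModule.toEnd_apply_apply,
      LieModule.toEnd_apply_apply, leibniz_lie F, lie_E_pow, lie_zero, add_zero]

/-- Bracketing with F^l commutes with ad_F, so all A copies of ad_F can be moved from E^{m'} onto
E^k. -/
theorem trace_lie_pow_mul_adPow (k l m' A : ℕ) :
    (⁅E ^ k, F ^ l⁆ * adPow E F m' A).trace =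
      -(-1) ^ A * (adPow E F k A * ⁅E ^ m', F ^ l⁆).trace := by
  have h := trace_toEnd_pow_mul (F := F) A ⁅E ^ k, F ^ l⁆ (E ^ m')
  rw [lie_F_pow_iterate, trace_mul_lie_comm, ← lie_skew, mul_neg, Matrix.trace_neg] at h
  have hs : ((-1 : ℂ) ^ A) * (-1) ^ A = 1 := by rw [← mul_pow]; simp
  change -(adPow E F k A * ⁅E ^ m', F ^ l⁆).trace =
    (-1) ^ A * (⁅E ^ k, F ^ l⁆ * adPow E F m' A).trace at h
  linear_combination -(-1) ^ A * h - (⁅E ^ k, F ^ l⁆ * adPow E F m' A).trace * hs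

theorem structureConst_symm (t : IsSl2Triple H E F) (hF : ∀ i < n, F ^ i ≠ 0) {k l m m' : ℕ}
    (hm : Odd m) (hlt : m < 2 * min k l) (hm' : m' = k + l - m) :
    (-1 : ℂ) ^ (k + 1) * ((2 * m')! : ℂ) * (E ^ m' * F ^ m').trace * structureConst E F k l m =
      (E ^ l * F ^ l).trace * (((2 * k - m)! : ℂ) * ((2 * l)! : ℂ) / (m ! : ℂ)) *
        structureConst E F m' k (2 * k - m) := by
  obtain ⟨A, hA⟩ : ∃ A, A + m = 2 * k := ⟨2 * k - m, by omega⟩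
  obtain ⟨B, hB⟩ : ∃ B, B + m = 2 * l := ⟨2 * l - m, by omega⟩
  have e1 : 2 * k - m = A := by omega
  have e2 : 2 * l - m = B := by omega
  have e3 : 2 * k - A = m := by omega
  have e4 : k + l - m = m' := hm'.symm
  have e5 : m' + k - A = l := by omega
  have hAodd : Odd A := by
    rw [← Nat.not_even_iff_odd]
    intro h
    exact Nat.not_odd_iff_even.2 (hA ▸ even_two_mul k) (h.add_odd hm)
  have hBodd : Odd B := by
    rw [← Nat.not_even_iff_odd]
    intro h
    exact Nat.not_odd_iff_even.2 (hB ▸ even_two_mul l) (h.add_odd hm)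
  -- The dual of G_{m', k-l} is G_{m', l-k}, which is A = 2k - m steps down its string.
  have h1 := gCoeff_mul_trace (E := E) t hF (trace_lie (E ^ k) (F ^ l)) (i := m') (a := B) (b := A)
    (j := (k : ℤ) - l) (by omega) (by omega)
  have h2 := gCoeff_mul_trace (E := E) t hF (trace_lie (E ^ m') (F ^ k)) (i := l) (a := m) (b := B)
    (j := (m' : ℤ) - k) (by omega) (by omega)
  rw [trace_adPow_mul_adPow_dual t (by omega), trace_lie_pow_mul_adPow, hAodd.neg_one_pow,
    hBodd.neg_one_pow] at h1
  rw [trace_adPow_mul_adPow_dual t (by omega), trace_lie_mul, hm.neg_one_pow] at h2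
  have h3 := trace_pairing_symm t (lie_E_pow (E := E) m') hA hB
  rw [(adPow_top t k).1, (adPow_top t l).1, lie_smul, smul_mul_assoc, mul_smul_comm,
    Matrix.trace_smul, Matrix.trace_smul, smul_eq_mul, smul_eq_mul, hm.neg_one_pow] at h3
  have hsign : (-1 : ℂ) ^ m' = -((-1) ^ k * (-1) ^ l) := by
    have : m' + m = k + l := by omega
    rw [← pow_add, ← this, pow_add, hm.neg_one_pow]
    ring
  have hk0 : ((2 * k)! : ℂ) ≠ 0 := by exact_mod_cast Nat.factorial_ne_zero _
  have hl0 : ((2 * l)! : ℂ) ≠ 0 := by exact_mod_cast Nat.factorial_ne_zero _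
  have hm0 : (m ! : ℂ) ≠ 0 := by exact_mod_cast Nat.factorial_ne_zero _
  have hs0 : (-1 : ℂ) ^ l ≠ 0 := pow_ne_zero _ (by norm_num)
  simp only [structureConst, e1, e2, e3, e4, e5]
  rw [hsign] at h1
  rw [pow_succ]
  generalize gCoeff E F ⁅E ^ k, F ^ l⁆ m' ((k : ℤ) - l) = c₁ at *
  generalize gCoeff E F ⁅E ^ m', F ^ k⁆ l ((m' : ℤ) - k) = c₂ at *
  generalize (E ^ m' * F ^ m').trace = t₁ at *
  generalize (E ^ l * F ^ l).trace = t₂ at *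
  generalize (adPow E F k A * ⁅E ^ m', F ^ l⁆).trace = q₀ at *
  generalize (F ^ k * ⁅E ^ m', adPow E F l B⁆).trace = q₁ at *
  generalize (-1 : ℂ) ^ k = sk at *
  generalize (-1 : ℂ) ^ l = sl at *
  have h1' : q₀ = c₁ * (sk * sl * (2 * m')! * t₁) := by linear_combination -h1
  have h2' : q₁ = c₂ * (sl * (2 * l)! * t₂) := by linear_combination h2
  rw [h1', h2'] at h3
  have h4 : t₂ * ((A ! : ℂ) * (2 * l)! / m !) * (sk * m ! * c₂) =
      t₂ * (A ! : ℂ) * (2 * l)! * sk * c₂ := by field_simp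
  rw [h4]
  -- Only factorials and signs are cancelled; the traces t₁ and t₂ may vanish.
  refine mul_left_cancel₀ (mul_ne_zero (mul_ne_zero hk0 hl0) hs0) ?_
  linear_combination -h3

/-! ### Passage from principal triples to matrices -/

theorem IsPrincipalTriple.isSl2Triple_matrix {E H F : SL n} (h : IsPrincipalTriple E H F) :
    IsSl2Triple H.1 E.1 F.1 where
  h_ne_zero h0 := h.triple.h_ne_zero (Subtype.ext h0)
  lie_e_f := congrArg Subtype.val h.triple.lie_e_f
  lie_h_e_nsmul := congrArg Subtype.val h.triple.lie_h_e_nsmul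
  lie_h_f_nsmul := congrArg Subtype.val h.triple.lie_h_f_nsmul

theorem IsPrincipalTriple.isPrincipalNilpotent_right {E H F : SL n}
    (h : IsPrincipalTriple E H F) : IsPrincipalNilpotent F := by
  simpa using h.principal 0 0 1 (by simp) (by simp)

end

end PrincipalBasis

theorem mainTheorem4 (n : ℕ) (E H F : Matrix (Fin n) (Fin n) ℂ)
    (hE : E ∈ LieAlgebra.SpecialLinear.sl (Fin n) ℂ)
    (hH : H ∈ LieAlgebra.SpecialLinear.sl (Fin n) ℂ)
    (hF : F ∈ LieAlgebra.SpecialLinear.sl (Fin n) ℂ)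
    (hEHF : PrincipalBasis.IsPrincipalTriple
      (⟨E, hE⟩ : PrincipalBasis.SL n) ⟨H, hH⟩ ⟨F, hF⟩) :
    (LinearIndependent ℂ
        (fun p : PrincipalBasis.gIndex n => PrincipalBasis.G E F p.1.1 p.1.2) ∧
      Submodule.span ℂ
        (Set.range fun p : PrincipalBasis.gIndex n => PrincipalBasis.G E F p.1.1 p.1.2) =
          LinearMap.ker (Matrix.traceLinearMap (Fin n) ℂ ℂ)) ∧
    ∀ k l m m' : ℕ, 1 ≤ k → k < n → 1 ≤ l → l < n → Odd m → m < 2 * min k l →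
      m' = k + l - m →
      (-1 : ℂ) ^ (k + 1) * ((2 * m')! : ℂ) * (E ^ m' * F ^ m').trace *
          PrincipalBasis.structureConst E F k l m =
        (E ^ l * F ^ l).trace * (((2 * k - m)! : ℂ) * ((2 * l)! : ℂ) / (m ! : ℂ)) *
          PrincipalBasis.structureConst E F m' k (2 * k - m) := by
  have t := hEHF.isSl2Triple_matrix
  have hpow : ∀ i < n, F ^ i ≠ 0 := fun i hi => hEHF.isPrincipalNilpotent_right.pow_ne_zero hi
  exact ⟨⟨PrincipalBasis.linearIndependent_G t hpow, PrincipalBasis.span_G t hpow⟩,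
    fun k l m m' _ _ _ _ hm hlt hm' => PrincipalBasis.structureConst_symm t hpow hm hlt hm'⟩
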